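/- **Model.** Worker types are pairs $(v,\ell)\in[0,1]^2$ ($v$ is productivity, $\ell$ an index), distributed according to $\mu=\mu^{\mathrm p}\otimes\mu^{\mathrm w}$, where $\mu^{\mathrm p}$ has a measurable density $f$ with respect to Lebesgue measure on $[0,1]$ with $0<\inf f\le\sup f<\infty$, and $\mu^{\mathrm w}$ is a non-atomic Borel probability measure on $[0,1]$. Measurability is understood with respect to the completed measures. There are two firms $i\in\{1,2\}$. *Stage 1.* The firms simultaneously announce measurable sets $\mathcal S_i\subseteq[0,1]^2$ of workers who receive an offer and measurable wage offers $\mathcal w_i:\mathcal S_i\to[0,\infty)$ which are monotone: $\mathcal w_i(v,\ell)\ge\mathcal w_i(v',\ell')$ whenever $(v,\ell),(v',\ell')\in\mathcal S_i$ and $v\ge v'$. *Stage 2.* Each worker observes which firms made her an offer and at which wages, and accepts one of these offers or stays unassigned. A worker's payoff is the wage she accepts, or $0$ if she is unassigned. If $S_i\subseteq\mathcal S_i$ is the set of workers who accept firm $i$'s offer, then firm $i$'s payoff is $\int_{S_i}(v-\mathcal w_i(v,\ell))\,d\mu\in[-\infty,\infty)$ if $S_i$ is measurable and $-1$ otherwise.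 An *equilibrium* is a pure-strategy subgame perfect Nash equilibrium: each worker's acceptance decision is optimal for her after every pair of announcements, and no firm can raise its payoff by changing its announcement, given the other firm's announcement and the workers' strategies. An *allocation* consists of measurable functions $f_i,w_i:[0,1]\to[0,\infty)$, $i=1,2$, with $f_i\le f$ and $f_1+f_2\le f$ pointwise, and $w_i(v)=0$ whenever $f_i(v)=0$. A strategy profile *induces* it if $S_1,S_2$ are measurable and, for each $i$ and almost every $v\in[0,1]$, $f_i(v)=f(v)\,\mu^{\mathrm w}(\{\ell:(v,\ell)\in S_i\})$ and, if $f_i(v)>0$, every worker $(v,\ell)\in S_i$ is paid $\mathcal w_i(v,\ell)=w_i(v)$. It is a *Bertrand allocation* if for each $i\in\{1,2\}$ and almost every $v\in[0,1]$: $f_1(v)+f_2(v)=f(v)$, and $w_i(v)=v$ if $f_i(v)>0$. **Theorem.** An allocation can be induced by an equilibrium if and only if it is a Bertrand allocation. -/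

import Mathlib

open MeasureTheory

namespace WageGame

noncomputable section

/-- A worker type `(v, ℓ) ∈ [0,1]²`: productivity `v` and index `ℓ`. -/
abbrev Worker : Type := unitInterval × unitInterval

/-- The distribution of worker types: the product of the productivity measure, which has density `f`
with respect to Lebesgue measure on `[0,1]`, and the index measure `ν`. -/
def workerMeasure (f : unitInterval → ℝ) (ν : Measure unitInterval) : Measure Worker :=
  ((volume : Measure unitInterval).withDensity fun v => ENNReal.ofReal (f v)).prod ν

/-- What a worker observes: for each of the two firms, either no offer (`none`) or the wage which
that firm offers to her. -/
abbrev OffersToWorker : Type := Fin 2 → Option ℝ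

/-- A pure strategy of a firm: the set of workers to which it makes offers, with the wage offered to
each of them, where `offer x = none` means that `x` receives no offer. The set of recipients and the
wage function on it are measurable with respect to the completion of `μ`, and the wage offers are
non-negative and monotone non-decreasing in productivity. -/
structure Announcement (μ : Measure Worker) where
  offer : Worker → Option ℝ
  measurable_recipients : NullMeasurableSet {x | (offer x).isSome} μ
  measurable_wage : ∀ c : ℝ, NullMeasurableSet {x | ∃ w, offer x = some w ∧ c < w} μ
  nonneg_wage : ∀ (x : Worker) (w : ℝ), offer x = some w → 0 ≤ w
  monotone_wage : ∀ (x y : Worker) (w w' : ℝ), offer x = some w → offer y = some w' →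
    y.1 ≤ x.1 → w' ≤ w

/-- A worker can always stay unassigned (`none`); she can work for firm `i` only if it made her an
offer. -/
def IsAvailable (o : OffersToWorker) : Option (Fin 2) → Prop
  | none => True
  | some i => (o i).isSome

/-- A worker's payoff: the wage of the offer she accepts, and zero if she stays unassigned. -/
def workerPayoff (o : OffersToWorker) : Option (Fin 2) → ℝ
  | none => 0
  | some i => (o i).getD 0

/-- A pure strategy of a worker: an available choice for each pair of offers she may observe. -/
structure AcceptanceRule where
  choice : OffersToWorker → Option (Fin 2)
  available : ∀ o, IsAvailable o (choice o)

/-- A profile of pure strategies of the two firms and of all workers. -/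
structure StrategyProfile (μ : Measure Worker) where
  announce : Fin 2 → Announcement μ
  accept : Worker → AcceptanceRule

/-- The offers observed by worker `x` when the firms announce `a`. -/
def offersTo {μ : Measure Worker} (a : Fin 2 → Announcement μ) (x : Worker) : OffersToWorker :=
  fun i => (a i).offer x

/-- The set of workers who accept the offer of firm `i`. -/
def hired {μ : Measure Worker} (a : Fin 2 → Announcement μ) (τ : Worker → AcceptanceRule)
    (i : Fin 2) : Set Worker :=
  {x | (τ x).choice (offersTo a x) = some i}

/-- The profit `v - w` that firm `i` makes on worker `x` if she accepts its offer. -/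
def margin {μ : Measure Worker} (a : Fin 2 → Announcement μ) (i : Fin 2) (x : Worker) : ℝ :=
  (x.1 : ℝ) - ((a i).offer x).getD 0

open Classical in
/-- The payoff of firm `i`: the integral of `v - w` over the workers it hires if these form a
measurable set, and `-1` otherwise. As `v - w ≤ 1`, the integral always exists in `[-∞, ∞)`: it is
`-∞` exactly when the (measurable) integrand fails to be integrable. -/
def firmPayoff {μ : Measure Worker} (a : Fin 2 → Announcement μ) (τ : Worker → AcceptanceRule)
    (i : Fin 2) : EReal :=
  if NullMeasurableSet (hired a τ i) μ then
    if IntegrableOn (margin a i) (hired a τ i) μ then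
      ((∫ x in hired a τ i, margin a i x ∂μ : ℝ) : EReal)
    else ⊥
  else -1

/-- Nash equilibrium of the subgame that follows the announcements `a`: no worker can gain by making
another available choice. -/
def IsWorkerNash {μ : Measure Worker} (a : Fin 2 → Announcement μ) (τ : Worker → AcceptanceRule) :
    Prop :=
  ∀ (x : Worker) (c : Option (Fin 2)), IsAvailable (offersTo a x) c →
    workerPayoff (offersTo a x) c ≤
      workerPayoff (offersTo a x) ((τ x).choice (offersTo a x))

/-- Nash equilibrium of the whole game: no firm and no worker can gain by a unilateral deviation. -/
def IsNash {μ : Measure Worker} (σ : StrategyProfile μ) : Prop :=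
  (∀ (i : Fin 2) (b : Announcement μ),
    firmPayoff (Function.update σ.announce i b) σ.accept i ≤ firmPayoff σ.announce σ.accept i) ∧
  IsWorkerNash σ.announce σ.accept

/-- Pure-strategy subgame perfect Nash equilibrium: a Nash equilibrium which induces a Nash
equilibrium of the workers' subgame after every pair of announcements. -/
def IsSubgamePerfect {μ : Measure Worker} (σ : StrategyProfile μ) : Prop :=
  IsNash σ ∧ ∀ a : Fin 2 → Announcement μ, IsWorkerNash a σ.accept

/-- An allocation: for each firm `i` and productivity `v`, the density of workers of productivity `v`
hired by `i` and the wage which `i` pays to them (set to `0` if the density is `0`). Measurability is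
Lebesgue measurability, i.e. measurability with respect to the completion of Lebesgue measure. -/
structure Allocation (f : unitInterval → ℝ) where
  density : Fin 2 → unitInterval → ℝ
  wage : Fin 2 → unitInterval → ℝ
  measurable_density : ∀ i, AEMeasurable (density i) volume
  measurable_wage : ∀ i, AEMeasurable (wage i) volume
  density_nonneg : ∀ i v, 0 ≤ density i v
  density_le : ∀ i v, density i v ≤ f v
  wage_nonneg : ∀ i v, 0 ≤ wage i v
  wage_eq_zero : ∀ i v, density i v = 0 → wage i v = 0
  feasible : ∀ v, density 0 v + density 1 v ≤ f v

/-- A Bertrand allocation: almost every worker is hired, and almost every hired worker is paid her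
productivity. -/
def Allocation.IsBertrand {f : unitInterval → ℝ} (A : Allocation f) : Prop :=
  ∀ i : Fin 2, ∀ᵐ v : unitInterval, A.density 0 v + A.density 1 v = f v ∧
    (0 < A.density i v → A.wage i v = (v : ℝ))

/-- The strategy profile `σ` induces the allocation `A`: the sets of hired workers are measurable and,
for almost every productivity `v`, the density `f v * ν {ℓ | (v, ℓ) is hired by i}` of the workers
of productivity `v` hired by firm `i` is the one of `A`, and (if it is positive) the wage which `i`
pays to each of these workers is the one of `A`. -/
def Induces {f : unitInterval → ℝ} {ν : Measure unitInterval}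
    (σ : StrategyProfile (workerMeasure f ν)) (A : Allocation f) : Prop :=
  ∀ i : Fin 2,
    NullMeasurableSet (hired σ.announce σ.accept i) (workerMeasure f ν) ∧
    ∀ᵐ v : unitInterval,
      A.density i v = f v * (ν {l | (v, l) ∈ hired σ.announce σ.accept i}).toReal ∧
      (0 < A.density i v → ∀ l, (v, l) ∈ hired σ.announce σ.accept i →
        (σ.announce i).offer (v, l) = some (A.wage i v))

end

end WageGame

/-! Necessity rests on each firm being able to copy and slightly outbid the other's profitable
offers. Let `G_i` be the matching wage of firm `i`, `U_i` its undercuttable set and `E_i ⊆ U_i` the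
workers it hires below productivity. Firm `j` can win all of `U_i` at wages just above `G_i`. Since
`G_i` equals firm `i`'s own wage on `E_i`, this deviation earns firm `i`'s profit, plus its losses
on overpaid workers, plus `∫ (v - G_i)` over `U_i \ E_i`. Equilibrium bounds the sum by the profit
of `j`. The two symmetric bounds together force both nonnegative extra terms to vanish
(`undercutting_bound`, `undercutting_ae`).

Hence `G_i = v` almost everywhere on `U_i \ E_i`, and almost nobody is overpaid. A monotonicity
argument then shows that `E_i` is null (`hiredBelow_ae_empty`), so wages equal productivity and
profits are zero. Unassigned workers could be hired at almost no cost, so they form a null set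
(`hired_ae_or`).

For sufficiency, both firms offer everyone her productivity, so no deviation can hire at a positive
margin. Ties are broken by the index, and the absence of atoms allows any prescribed split at each
productivity. -/

namespace WageGame

/-- The wage offered to a worker, with value `0` if she receives no offer. -/
noncomputable def wageOf {μ : Measure Worker} (a : Announcement μ) (x : Worker) : ℝ :=
  (a.offer x).getD 0

/-- The workers to whom an announcement does not offer a wage of at least their productivity. -/
def undercuttable {μ : Measure Worker} (a : Announcement μ) : Set Worker :=
  {x | ∀ w, a.offer x = some w → w < x.1}

/-- The smallest monotone wage schedule which matches all offers below productivity. -/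
noncomputable def matchingWage {μ : Measure Worker} (a : Announcement μ) (v : unitInterval) : ℝ :=
  sSup (insert 0 {w | ∃ x : Worker, a.offer x = some w ∧ w < x.1 ∧ x.1 ≤ v})

/-- The workers hired by firm `i` below their productivity. -/
def hiredBelow {μ : Measure Worker} (a : Fin 2 → Announcement μ) (τ : Worker → AcceptanceRule)
    (i : Fin 2) : Set Worker :=
  hired a τ i ∩ {x | wageOf (a i) x < x.1}

section

variable {μ : Measure Worker}

/-! ### Offers, matching wages and optimal acceptance -/

lemma wageOf_eq {a : Announcement μ} {x : Worker} {w : ℝ} (h : a.offer x = some w) :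
    wageOf a x = w := by simp [wageOf, h]

lemma wageOf_nonneg (a : Announcement μ) (x : Worker) : 0 ≤ wageOf a x := by
  cases h : a.offer x with
  | none => simp [wageOf, h]
  | some w => rw [wageOf_eq h]; exact a.nonneg_wage x w h

lemma aemeasurable_wageOf (a : Announcement μ) : AEMeasurable (wageOf a) μ := by
  refine NullMeasurable.aemeasurable (μ := μ) ?_
  refine measurable_of_Ioi (mδ := NullMeasurableSpace.instMeasurableSpace (μ := μ)) fun c => ?_
  change NullMeasurableSet (wageOf a ⁻¹' Set.Ioi c) μ
  rcases lt_or_ge c 0 with hc | hc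
  · have : wageOf a ⁻¹' Set.Ioi c = Set.univ :=
      Set.eq_univ_of_forall fun x => hc.trans_le (wageOf_nonneg a x)
    rw [this]; exact MeasurableSet.univ.nullMeasurableSet
  · have : wageOf a ⁻¹' Set.Ioi c = {x | ∃ w, a.offer x = some w ∧ c < w} := by
      ext x
      constructor
      · intro h
        cases h' : a.offer x with
        | none =>
          simp only [Set.mem_preimage, Set.mem_Ioi, wageOf, h', Option.getD_none] at h
          exact absurd h (not_lt.2 hc)
        | some w =>
          simp only [Set.mem_preimage, Set.mem_Ioi, wageOf_eq h'] at h
          exact ⟨w, h', h⟩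
      · rintro ⟨w, h, hw⟩
        simpa [wageOf_eq h] using hw
    rw [this]; exact a.measurable_wage c

lemma aemeasurable_productivity : AEMeasurable (fun x : Worker => (x.1 : ℝ)) μ := by
  fun_prop

lemma nullMeasurableSet_wageOf_lt (a : Announcement μ) :
    NullMeasurableSet {x | wageOf a x < x.1} μ :=
  nullMeasurableSet_lt (aemeasurable_wageOf a) aemeasurable_productivity

lemma nullMeasurableSet_undercuttable (a : Announcement μ) :
    NullMeasurableSet (undercuttable a) μ := by
  have : undercuttable a = {x | (a.offer x).isSome}ᶜ ∪ {x | wageOf a x < x.1} := by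
    ext x
    cases h : a.offer x with
    | none => simp [undercuttable, h]
    | some w => simp [undercuttable, h, wageOf_eq h]
  rw [this]
  exact a.measurable_recipients.compl.union (nullMeasurableSet_wageOf_lt a)

lemma matchingWage_mem_upperBounds (a : Announcement μ) (v : unitInterval) :
    (v : ℝ) ∈ upperBounds
      (insert 0 {w | ∃ x : Worker, a.offer x = some w ∧ w < x.1 ∧ x.1 ≤ v}) := by
  rintro w (rfl | ⟨x, -, h, h'⟩)
  · exact v.2.1
  · exact h.le.trans h'

lemma matchingWage_nonneg (a : Announcement μ) (v : unitInterval) : 0 ≤ matchingWage a v :=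
  le_csSup ⟨_, matchingWage_mem_upperBounds a v⟩ (Set.mem_insert _ _)

lemma matchingWage_le (a : Announcement μ) (v : unitInterval) : matchingWage a v ≤ v :=
  csSup_le (Set.insert_nonempty _ _) (matchingWage_mem_upperBounds a v)

lemma monotone_matchingWage (a : Announcement μ) : Monotone (matchingWage a) := by
  intro v v' h
  refine csSup_le_csSup ⟨_, matchingWage_mem_upperBounds a v'⟩ (Set.insert_nonempty _ _) ?_
  refine Set.insert_subset_insert ?_
  rintro w ⟨x, h1, h2, h3⟩
  exact ⟨x, h1, h2, h3.trans h⟩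

/-- By monotonicity of the announcement, no worker of productivity at most `x.1` is offered more
than `w`, so the supremum is attained at `x` itself. -/
lemma matchingWage_eq {a : Announcement μ} {x : Worker} {w : ℝ} (h : a.offer x = some w)
    (hw : w < x.1) : matchingWage a x.1 = w := by
  refine le_antisymm (csSup_le (Set.insert_nonempty _ _) ?_)
    (le_csSup ⟨_, matchingWage_mem_upperBounds a x.1⟩ (Or.inr ⟨x, h, hw, le_rfl⟩))
  rintro u (rfl | ⟨y, hy, -, hyx⟩)
  · exact a.nonneg_wage x w h
  · exact a.monotone_wage x y w u h hy hyx

lemma exists_offer_of_lt_matchingWage {a : Announcement μ} {v : unitInterval} {c : ℝ} (hc : 0 ≤ c)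
    (h : c < matchingWage a v) :
    ∃ (y : Worker) (w : ℝ), a.offer y = some w ∧ w < y.1 ∧ y.1 ≤ v ∧ c < w := by
  obtain ⟨w, rfl | ⟨y, h1, h2, h3⟩, hw⟩ := exists_lt_of_lt_csSup (Set.insert_nonempty _ _) h
  · exact absurd hw (not_lt.2 hc)
  · exact ⟨y, w, h1, h2, h3, hw⟩

lemma exists_offer_of_mem_hired {a : Fin 2 → Announcement μ} {τ : Worker → AcceptanceRule}
    {i : Fin 2} {x : Worker} (h : x ∈ hired a τ i) : ∃ w, (a i).offer x = some w := by
  have := (τ x).available (offersTo a x)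
  rw [show (τ x).choice (offersTo a x) = some i from h] at this
  exact Option.isSome_iff_exists.1 this

lemma offer_of_mem_hired {a : Fin 2 → Announcement μ} {τ : Worker → AcceptanceRule}
    {i : Fin 2} {x : Worker} (h : x ∈ hired a τ i) :
    (a i).offer x = some (wageOf (a i) x) := by
  obtain ⟨w, hw⟩ := exists_offer_of_mem_hired h
  rw [wageOf_eq hw, hw]

lemma eq_of_mem_hired {a : Fin 2 → Announcement μ} {τ : Worker → AcceptanceRule}
    {i j : Fin 2} {x : Worker} (hi : x ∈ hired a τ i) (hj : x ∈ hired a τ j) : i = j :=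
  Option.some_injective _
    ((show (τ x).choice (offersTo a x) = some i from hi).symm.trans hj)

lemma IsWorkerNash.le_wageOf {a : Fin 2 → Announcement μ} {τ : Worker → AcceptanceRule}
    (hN : IsWorkerNash a τ) {i j : Fin 2} {x : Worker} (hi : x ∈ hired a τ i) {w : ℝ}
    (hw : (a j).offer x = some w) : w ≤ wageOf (a i) x := by
  have := hN x (some j) (by simp [IsAvailable, offersTo, hw])
  rw [show (τ x).choice (offersTo a x) = some i from hi] at this
  simpa [workerPayoff, offersTo, hw, wageOf] using this

lemma margin_eq (a : Fin 2 → Announcement μ) (i : Fin 2) (x : Worker) :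
    margin a i x = x.1 - wageOf (a i) x := rfl

/-! ### Deviations by overbidding -/

open Classical in
/-- The announcement which offers the wage `g v` to all workers of productivity `v` in `T`. -/
noncomputable def scheduleOn (T : Set Worker) (hT : NullMeasurableSet T μ) (g : unitInterval → ℝ)
    (hg : Monotone g) (h0 : ∀ v, 0 ≤ g v) : Announcement μ where
  offer x := if x ∈ T then some (g x.1) else none
  measurable_recipients := by
    convert hT using 1
    ext x
    by_cases hx : x ∈ T <;> simp [hx]
  measurable_wage c := by
    have : {x : Worker | ∃ w, (if x ∈ T then some (g x.1) else none) = some w ∧ c < w}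
        = T ∩ (fun x : Worker => g x.1) ⁻¹' Set.Ioi c := by
      ext x
      by_cases hx : x ∈ T <;> simp [hx]
    rw [this]
    exact hT.inter ((hg.measurable.comp measurable_fst) measurableSet_Ioi).nullMeasurableSet
  nonneg_wage x w h := by
    by_cases hx : x ∈ T
    · simp only [hx, if_true, Option.some.injEq] at h
      exact h ▸ h0 _
    · simp [hx] at h
  monotone_wage x y w w' h h' hxy := by
    by_cases hx : x ∈ T
    · by_cases hy : y ∈ T
      · simp only [hx, hy, if_true, Option.some.injEq] at h h'
        rw [← h, ← h']
        exact hg hxy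
      · simp [hy] at h'
    · simp [hx] at h

section
variable {T : Set Worker} {hT : NullMeasurableSet T μ} {g : unitInterval → ℝ}
  {hg : Monotone g} {h0 : ∀ v, 0 ≤ g v} {x : Worker}

lemma scheduleOn_offer (hx : x ∈ T) : (scheduleOn T hT g hg h0).offer x = some (g x.1) := by
  simp [scheduleOn, hx]

lemma scheduleOn_offer_of_notMem (hx : x ∉ T) : (scheduleOn T hT g hg h0).offer x = none := by
  simp [scheduleOn, hx]

lemma mem_of_scheduleOn_offer {w : ℝ} (h : (scheduleOn T hT g hg h0).offer x = some w) :
    x ∈ T := by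
  by_contra hx
  simp [scheduleOn_offer_of_notMem hx] at h

end

variable [IsFiniteMeasure μ]

lemma integrable_productivity_sub {g : unitInterval → ℝ} (hg : Monotone g)
    (h0 : ∀ v, 0 ≤ g v) : Integrable (fun x : Worker => (x.1 : ℝ) - g x.1) μ := by
  have hm : Measurable fun x : Worker => (x.1 : ℝ) - g x.1 :=
    (measurable_subtype_coe.comp measurable_fst).sub (hg.measurable.comp measurable_fst)
  refine Integrable.of_bound hm.aestronglyMeasurable (1 + g 1) (ae_of_all _ fun x => ?_)
  rw [Real.norm_eq_abs, abs_le]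
  have h2 := h0 x.1
  have h3 := x.1.2.1
  have h4 := x.1.2.2
  have h5 : g x.1 ≤ g 1 := hg unitInterval.le_one'
  constructor <;> linarith

/-- In an equilibrium a firm earns at least what it would earn by slightly overbidding the wage
schedule `g` on a set of workers whose offers by its competitor do not exceed `g`. -/
lemma IsSubgamePerfect.integral_sub_le_firmPayoff {σ : StrategyProfile μ}
    (hσ : IsSubgamePerfect σ) {i j : Fin 2} (hij : i ≠ j) {T : Set Worker}
    (hT : NullMeasurableSet T μ) {g : unitInterval → ℝ} (hg : Monotone g) (h0 : ∀ v, 0 ≤ g v)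
    (hcomp : ∀ x ∈ T, ∀ w, (σ.announce j).offer x = some w → w ≤ g x.1) {ε : ℝ} (hε : 0 < ε) :
    ((∫ x in T, ((x.1 : ℝ) - g x.1 - ε) ∂μ : ℝ) : EReal)
      ≤ firmPayoff σ.announce σ.accept i := by
  have hg' : Monotone fun v => g v + ε := fun v v' h => add_le_add_left (hg h) ε
  have h0' : ∀ v, 0 ≤ g v + ε := fun v => add_nonneg (h0 v) hε.le
  set b : Announcement μ := scheduleOn T hT (fun v => g v + ε) hg' h0'
  set a' := Function.update σ.announce i b with ha'
  have hai : a' i = b := by simp [ha']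
  have haj : a' j = σ.announce j := by simp [ha', hij.symm]
  -- Subgame perfection makes acceptance optimal after the deviation too. The strictly positive `ε`
  -- makes the new offer strictly best on `T`, so tie-breaking plays no role.
  have hN := hσ.2 a'
  have hH : hired a' σ.accept i = T := by
    ext x
    constructor
    · intro hx
      obtain ⟨w, hw⟩ := exists_offer_of_mem_hired hx
      rw [hai] at hw
      exact mem_of_scheduleOn_offer hw
    · intro hx
      have hoff : (a' i).offer x = some (g x.1 + ε) := by rw [hai]; exact scheduleOn_offer hx
      have hbest := hN x (some i) (by simp [IsAvailable, offersTo, hoff])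
      simp only [workerPayoff, offersTo, hoff, Option.getD_some] at hbest
      have hx0 := h0 x.1
      cases hc : (σ.accept x).choice (offersTo a' x) with
      | none =>
        change _ ≤ workerPayoff _ ((σ.accept x).choice (offersTo a' x)) at hbest
        rw [hc] at hbest
        simp only [workerPayoff] at hbest
        linarith
      | some k =>
        by_cases hk : k = i
        · subst hk; exact hc
        · have hkj : k = j := by omega
          subst hkj
          have hxk : x ∈ hired a' σ.accept k := hc
          obtain ⟨w, hw⟩ := exists_offer_of_mem_hired hxk
          have h1 := hN.le_wageOf hxk hoff
          rw [wageOf_eq hw] at h1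
          rw [haj] at hw
          have h2 := hcomp x hx w hw
          linarith
  have hmargin : ∀ x ∈ T, margin a' i x = (x.1 : ℝ) - g x.1 - ε := by
    intro x hx
    rw [margin_eq, hai, wageOf_eq (scheduleOn_offer hx)]
    ring
  have hres : ∀ᵐ x ∂μ.restrict T, (x.1 : ℝ) - g x.1 - ε = margin a' i x :=
    (ae_restrict_iff'₀ hT).2 (ae_of_all _ fun x hx => (hmargin x hx).symm)
  have hint : IntegrableOn (fun x : Worker => (x.1 : ℝ) - g x.1 - ε) T μ :=
    ((integrable_productivity_sub hg h0).sub (integrable_const ε)).integrableOn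
  have hpay : firmPayoff a' σ.accept i
      = ((∫ x in T, ((x.1 : ℝ) - g x.1 - ε) ∂μ : ℝ) : EReal) := by
    have hint' : IntegrableOn (margin a' i) T μ := hint.congr hres
    rw [firmPayoff, hH, if_pos hT, if_pos hint', integral_congr_ae hres]
  rw [← hpay]
  exact hσ.1.1 i b

/-! ### Equilibrium profits and mutual undercutting -/

variable {σ : StrategyProfile μ} {i j : Fin 2}

/-- Making no offers earns zero, which excludes the payoff `⊥` and bounds the equilibrium profit
below. -/
lemma IsSubgamePerfect.firmPayoff_eq (hσ : IsSubgamePerfect σ) (hij : i ≠ j)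
    (hH : NullMeasurableSet (hired σ.announce σ.accept i) μ) :
    IntegrableOn (margin σ.announce i) (hired σ.announce σ.accept i) μ ∧
    firmPayoff σ.announce σ.accept i
      = ((∫ x in hired σ.announce σ.accept i, margin σ.announce i x ∂μ : ℝ) : EReal) ∧
    0 ≤ ∫ x in hired σ.announce σ.accept i, margin σ.announce i x ∂μ := by
  have h := hσ.integral_sub_le_firmPayoff hij (T := ∅) MeasurableSet.empty.nullMeasurableSet
    (g := fun _ => 0) monotone_const (fun _ => le_rfl) (by simp) one_pos
  simp only [Measure.restrict_empty, integral_zero_measure, EReal.coe_zero] at h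
  by_cases hi : IntegrableOn (margin σ.announce i) (hired σ.announce σ.accept i) μ
  · have e : firmPayoff σ.announce σ.accept i
      = ((∫ x in hired σ.announce σ.accept i, margin σ.announce i x ∂μ : ℝ) : EReal) := by
      rw [firmPayoff, if_pos hH, if_pos hi]
    refine ⟨hi, e, ?_⟩
    rw [e] at h
    exact_mod_cast h
  · rw [firmPayoff, if_pos hH, if_neg hi] at h
    exact absurd h (by simp)

/-- The limit of `IsSubgamePerfect.integral_sub_le_firmPayoff` as the overbid vanishes. -/
lemma IsSubgamePerfect.integral_sub_le (hσ : IsSubgamePerfect σ) (hij : i ≠ j)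
    (hH : NullMeasurableSet (hired σ.announce σ.accept i) μ) {T : Set Worker}
    (hT : NullMeasurableSet T μ) {g : unitInterval → ℝ} (hg : Monotone g) (h0 : ∀ v, 0 ≤ g v)
    (hcomp : ∀ x ∈ T, ∀ w, (σ.announce j).offer x = some w → w ≤ g x.1) :
    ∫ x in T, ((x.1 : ℝ) - g x.1) ∂μ
      ≤ ∫ x in hired σ.announce σ.accept i, margin σ.announce i x ∂μ := by
  refine le_of_forall_pos_le_add fun ε hε => ?_
  have hm : 0 ≤ μ.real T := measureReal_nonneg
  -- Overbidding by this amount costs at most `ε` in total over `T`; the `+ 1` covers null `T`.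
  have hδ : 0 < ε / (μ.real T + 1) := by positivity
  have h := hσ.integral_sub_le_firmPayoff hij hT hg h0 hcomp hδ
  rw [(hσ.firmPayoff_eq hij hH).2.1, EReal.coe_le_coe_iff,
    integral_sub (integrable_productivity_sub hg h0).integrableOn (integrable_const _)] at h
  simp only [integral_const, MeasurableSet.univ, measureReal_restrict_apply, Set.univ_inter,
    smul_eq_mul] at h
  have : μ.real T * (ε / (μ.real T + 1)) ≤ ε := by
    rw [mul_div_assoc', div_le_iff₀ (by positivity)]
    nlinarith
  linarith

/-- Firm `j` overbids the matching wage of `i` on all of `undercuttable`. On `hiredBelow` this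
reproduces the margins of `i`; the second term is the gain on the other workers won, the third the
losses of `i` that `j` avoids. -/
lemma IsSubgamePerfect.undercutting_bound (hσ : IsSubgamePerfect σ) (hij : i ≠ j)
    (hH : ∀ k, NullMeasurableSet (hired σ.announce σ.accept k) μ) :
    (∫ x in hired σ.announce σ.accept i, margin σ.announce i x ∂μ)
      + (∫ x in undercuttable (σ.announce i) \ hiredBelow σ.announce σ.accept i,
          ((x.1 : ℝ) - matchingWage (σ.announce i) x.1) ∂μ)
      + (∫ x in hired σ.announce σ.accept i \ {x | wageOf (σ.announce i) x < x.1},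
          (wageOf (σ.announce i) x - x.1) ∂μ)
      ≤ ∫ x in hired σ.announce σ.accept j, margin σ.announce j x ∂μ := by
  have hU := nullMeasurableSet_undercuttable (σ.announce i)
  have hW := nullMeasurableSet_wageOf_lt (σ.announce i)
  have hE : NullMeasurableSet (hiredBelow σ.announce σ.accept i) μ := (hH i).inter hW
  have hg := integrable_productivity_sub (μ := μ) (monotone_matchingWage (σ.announce i))
    (matchingWage_nonneg (σ.announce i))
  have h1 := hσ.integral_sub_le hij.symm (hH j) hU
    (monotone_matchingWage (σ.announce i)) (matchingWage_nonneg (σ.announce i))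
    (fun x hx w hw => (matchingWage_eq hw (hx w hw)).ge)
  have hsub : hiredBelow σ.announce σ.accept i ⊆ undercuttable (σ.announce i) := by
    rintro x ⟨-, hx⟩ w hw
    exact wageOf_eq hw ▸ hx
  have h2 := integral_inter_add_sdiff₀ hE (hg.integrableOn (s := undercuttable (σ.announce i)))
  rw [Set.inter_eq_self_of_subset_right hsub] at h2
  have h3 := integral_inter_add_sdiff₀ hW (hσ.firmPayoff_eq hij (hH i)).1
  have h4 : ∫ x in hired σ.announce σ.accept i ∩ {x | wageOf (σ.announce i) x < x.1},
      margin σ.announce i x ∂μ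
      = ∫ x in hiredBelow σ.announce σ.accept i,
          ((x.1 : ℝ) - matchingWage (σ.announce i) x.1) ∂μ := by
    refine integral_congr_ae ((ae_restrict_iff'₀ hE).2 (ae_of_all _ ?_))
    rintro x ⟨hx, hx'⟩
    simp only [margin_eq]
    rw [matchingWage_eq (offer_of_mem_hired hx) hx']
  have h5 : ∫ x in hired σ.announce σ.accept i \ {x | wageOf (σ.announce i) x < x.1},
      (wageOf (σ.announce i) x - x.1) ∂μ
      = - ∫ x in hired σ.announce σ.accept i \ {x | wageOf (σ.announce i) x < x.1},
      margin σ.announce i x ∂μ := by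
    rw [← integral_neg]
    congr 1
    ext x
    rw [margin_eq]; ring
  linarith

/-- In an equilibrium almost every worker whom a competitor could profitably win at the matching wage
is already hired below her productivity, and almost no worker is paid more than her productivity. -/
lemma IsSubgamePerfect.undercutting_ae (hσ : IsSubgamePerfect σ) (hij : i ≠ j)
    (hH : ∀ k, NullMeasurableSet (hired σ.announce σ.accept k) μ) :
    (∀ᵐ x ∂μ, x ∈ undercuttable (σ.announce i) → x ∉ hiredBelow σ.announce σ.accept i →
      matchingWage (σ.announce i) x.1 = x.1) ∧
    (∀ᵐ x ∂μ, x ∈ hired σ.announce σ.accept i → wageOf (σ.announce i) x ≤ x.1) := by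
  have key : ∀ k : Fin 2,
      0 ≤ (∫ x in undercuttable (σ.announce k) \ hiredBelow σ.announce σ.accept k,
        ((x.1 : ℝ) - matchingWage (σ.announce k) x.1) ∂μ) ∧
      0 ≤ (∫ x in hired σ.announce σ.accept k \ {x | wageOf (σ.announce k) x < x.1},
        (wageOf (σ.announce k) x - x.1) ∂μ) := by
    intro k
    refine ⟨integral_nonneg fun x => sub_nonneg.2 (matchingWage_le _ _),
      integral_nonneg_of_ae ((ae_restrict_iff'₀ ((hH k).diff (nullMeasurableSet_wageOf_lt _))).2
        (ae_of_all _ fun x hx => sub_nonneg.2 (not_lt.1 hx.2)))⟩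
  -- Adding the two bounds cancels both profits, so the four nonnegative extra terms sum to at most
  -- zero.
  have hbi := hσ.undercutting_bound hij hH
  have hbj := hσ.undercutting_bound hij.symm hH
  obtain ⟨ki1, ki2⟩ := key i
  obtain ⟨kj1, kj2⟩ := key j
  have hW := nullMeasurableSet_wageOf_lt (σ.announce i)
  have hD1 := (nullMeasurableSet_undercuttable (σ.announce i)).diff ((hH i).inter hW)
  have hD2 := (hH i).diff hW
  constructor
  · have h0 := le_antisymm (by linarith) ki1
    rw [integral_eq_zero_iff_of_nonneg (fun x => sub_nonneg.2 (matchingWage_le _ _))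
      (integrable_productivity_sub (monotone_matchingWage _)
        (matchingWage_nonneg _)).integrableOn] at h0
    filter_upwards [(ae_restrict_iff'₀ hD1).1 h0] with x hx hU hE
    exact (sub_eq_zero.1 (hx ⟨hU, hE⟩)).symm
  · have h0 := le_antisymm (by linarith) ki2
    have hint : IntegrableOn (fun x => wageOf (σ.announce i) x - x.1)
        (hired σ.announce σ.accept i \ {x | wageOf (σ.announce i) x < x.1}) μ := by
      refine ((hσ.firmPayoff_eq hij (hH i)).1.mono_set Set.sdiff_subset).neg.congr
        (ae_of_all _ fun x => ?_)
      simp [margin_eq]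
    rw [setIntegral_eq_zero_iff_of_nonneg_ae ((ae_restrict_iff'₀ hD2).2
      (ae_of_all _ fun x hx => sub_nonneg.2 (not_lt.1 hx.2))) hint] at h0
    filter_upwards [(ae_restrict_iff'₀ hD2).1 h0] with x hx hh
    by_cases h : wageOf (σ.announce i) x < x.1
    · exact h.le
    · exact (sub_eq_zero.1 (hx ⟨hh, h⟩)).le

/-- If `i` hires `x` at a wage `a` below her productivity, the matching wage of `j` must equal
productivity almost everywhere between `a` and `x.1`. But a matching wage above `a` comes from an
offer `w` to some `y` with `w < y.1`, and this keeps the schedule at or below `w` on the whole gap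
up to `y.1`. The hypothesis `hpos` supplies generic workers in these gaps. -/
lemma IsSubgamePerfect.hiredBelow_ae_empty (hσ : IsSubgamePerfect σ) (hij : i ≠ j)
    (hH : ∀ k, NullMeasurableSet (hired σ.announce σ.accept k) μ)
    (hpos : ∀ p : Worker → Prop, (∀ᵐ x ∂μ, p x) → ∀ (c : ℝ) (v : unitInterval), 0 ≤ c → c < v →
      ∃ x : Worker, c < x.1 ∧ x.1 < v ∧ p x) :
    ∀ᵐ x ∂μ, x ∉ hiredBelow σ.announce σ.accept i := by
  have h1 := (hσ.undercutting_ae hij hH).1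
  have h2 := (hσ.undercutting_ae hij.symm hH).1
  have hN := hσ.1.2
  have h3 : ∀ᵐ x ∂μ, x ∈ hiredBelow σ.announce σ.accept i →
      matchingWage (σ.announce j) x.1 = x.1 := by
    -- A worker hired by `i` below productivity has no offer from `j` above that wage, so `j` leaves
    -- her undercuttable and does not hire her.
    filter_upwards [h2] with x hx hE
    refine hx (fun w hw => (hN.le_wageOf hE.1 hw).trans_lt hE.2) fun hE' => ?_
    exact hij (eq_of_mem_hired hE.1 hE'.1)
  filter_upwards [h3] with x hx3 hE
  have hx := offer_of_mem_hired hE.1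
  have hax : wageOf (σ.announce i) x < x.1 := hE.2
  have ha0 := wageOf_nonneg (σ.announce i) x
  have h4 : ∀ᵐ z ∂μ, wageOf (σ.announce i) x < z.1 → z.1 < x.1 →
      matchingWage (σ.announce j) z.1 = z.1 := by
    filter_upwards [h1, h3] with z hz1 hz3 haz hzx
    by_contra hne
    have hU : z ∈ undercuttable (σ.announce i) := fun w hw =>
      ((σ.announce i).monotone_wage x z _ w hx hw hzx.le).trans_lt haz
    -- If `j` does not match productivity at `z`, then `i` does not hire `z` below productivity, so
    -- the matching wage of `i` is `z.1`; yet it is at most its value `a` at `x`.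
    have hG := hz1 hU fun hEz => hne (hz3 hEz)
    have := monotone_matchingWage (σ.announce i) hzx.le
    rw [hG, matchingWage_eq hx hax] at this
    exact absurd haz (not_lt.2 this)
  obtain ⟨z, haz, hzx, hz⟩ := hpos _ h4 _ x.1 ha0 hax
  have hGz := hz haz hzx
  obtain ⟨y, w, hy, hwy, hyz, haw⟩ := exists_offer_of_lt_matchingWage ha0 (hGz ▸ haz)
  obtain ⟨z', hwz', hz'y, hz'⟩ := hpos _ h4 w y.1 (ha0.trans haw.le) hwy
  have hG' := hz' (haw.trans hwz') (hz'y.trans (hyz.trans_lt hzx))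
  have := monotone_matchingWage (σ.announce j) hz'y.le
  rw [hG', matchingWage_eq hy hwy] at this
  exact absurd hwz' (not_lt.2 this)

lemma IsSubgamePerfect.wage_eq_productivity_ae (hσ : IsSubgamePerfect σ) (hij : i ≠ j)
    (hH : ∀ k, NullMeasurableSet (hired σ.announce σ.accept k) μ)
    (hpos : ∀ p : Worker → Prop, (∀ᵐ x ∂μ, p x) → ∀ (c : ℝ) (v : unitInterval), 0 ≤ c → c < v →
      ∃ x : Worker, c < x.1 ∧ x.1 < v ∧ p x) :
    ∀ᵐ x ∂μ, x ∈ hired σ.announce σ.accept i → (σ.announce i).offer x = some (x.1 : ℝ) := by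
  filter_upwards [hσ.hiredBelow_ae_empty hij hH hpos, (hσ.undercutting_ae hij hH).2] with x h1 h2 hx
  rw [offer_of_mem_hired hx, le_antisymm (h2 hx) (not_lt.1 fun h => h1 ⟨hx, h⟩)]

/-- Profits are zero, and a worker left unassigned has no positive offer. Hiring all such workers at
a vanishing wage would earn the integral of their productivity, which must therefore be zero. -/
lemma IsSubgamePerfect.hired_ae_or (hσ : IsSubgamePerfect σ) (hij : i ≠ j)
    (hH : ∀ k, NullMeasurableSet (hired σ.announce σ.accept k) μ)
    (hpos : ∀ p : Worker → Prop, (∀ᵐ x ∂μ, p x) → ∀ (c : ℝ) (v : unitInterval), 0 ≤ c → c < v →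
      ∃ x : Worker, c < x.1 ∧ x.1 < v ∧ p x)
    (hzero : ∀ᵐ x ∂μ, x.1 ≠ 0) :
    ∀ᵐ x ∂μ, x ∈ hired σ.announce σ.accept i ∨ x ∈ hired σ.announce σ.accept j := by
  have hR : NullMeasurableSet
      (hired σ.announce σ.accept i ∪ hired σ.announce σ.accept j)ᶜ μ := ((hH i).union (hH j)).compl
  have hcomp : ∀ x ∈ (hired σ.announce σ.accept i ∪ hired σ.announce σ.accept j)ᶜ,
      ∀ w, (σ.announce j).offer x = some w → w ≤ 0 := by
    intro x hx w hw
    have hbest := hσ.1.2 x (some j) (by simp [IsAvailable, offersTo, hw])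
    cases hc : (σ.accept x).choice (offersTo σ.announce x) with
    | none => simpa [hc, workerPayoff, offersTo, hw] using hbest
    | some k =>
      refine absurd ?_ hx
      obtain rfl | rfl : k = i ∨ k = j := by omega
      · exact Or.inl hc
      · exact Or.inr hc
  have h1 := hσ.integral_sub_le hij (hH i) hR (g := fun _ => 0) monotone_const (fun _ => le_rfl) hcomp
  have h2 : ∫ x in hired σ.announce σ.accept i, margin σ.announce i x ∂μ = 0 := by
    refine integral_eq_zero_of_ae ((ae_restrict_iff'₀ (hH i)).2 ?_)
    filter_upwards [hσ.wage_eq_productivity_ae hij hH hpos] with x hx hh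
    rw [margin_eq, wageOf_eq (hx hh)]
    simp
  rw [h2] at h1
  have h3 := le_antisymm h1 (integral_nonneg fun x => by simpa using x.1.2.1)
  rw [integral_eq_zero_iff_of_nonneg (fun x => by simpa using x.1.2.1)
    (integrable_productivity_sub monotone_const fun _ => le_rfl).integrableOn] at h3
  filter_upwards [(ae_restrict_iff'₀ hR).1 h3, hzero] with x hx hx0
  by_contra hcon
  have := hx hcon
  simp only [sub_zero, Pi.zero_apply] at this
  exact hx0 (Subtype.ext this)

end

end WageGame

/-! ### From almost every worker to almost every productivity -/

namespace WageGame

lemma isFiniteMeasure_productivity {f : unitInterval → ℝ} (hf : ∃ C : ℝ, ∀ v, f v ≤ C) :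
    IsFiniteMeasure
      ((volume : Measure unitInterval).withDensity fun v => ENNReal.ofReal (f v)) := by
  obtain ⟨C, hC⟩ := hf
  refine isFiniteMeasure_withDensity (ne_of_lt ?_)
  calc ∫⁻ v, ENNReal.ofReal (f v) ≤ ∫⁻ _ : unitInterval, ENNReal.ofReal C :=
        lintegral_mono fun v => ENNReal.ofReal_le_ofReal (hC v)
    _ < ⊤ := by simp

lemma absolutelyContinuous_productivity {f : unitInterval → ℝ} (hf : AEMeasurable f volume)
    (hpos : ∀ v, 0 < f v) :
    (volume : Measure unitInterval) ≪
      (volume : Measure unitInterval).withDensity fun v => ENNReal.ofReal (f v) :=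
  withDensity_absolutelyContinuous' hf.ennreal_ofReal
    (ae_of_all _ fun v => (ENNReal.ofReal_pos.2 (hpos v)).ne')

section

variable {f : unitInterval → ℝ} {ν : Measure unitInterval}

lemma ae_ae_of_ae_workerMeasure [SFinite ν] (hf : AEMeasurable f volume) (hpos : ∀ v, 0 < f v)
    {p : Worker → Prop} (h : ∀ᵐ x ∂workerMeasure f ν, p x) :
    ∀ᵐ v : unitInterval, ∀ᵐ l ∂ν, p (v, l) :=
  (absolutelyContinuous_productivity hf hpos).ae_le (Measure.ae_ae_of_ae_prod h)

/-- Positivity of `f` gives every nondegenerate productivity interval positive mass, so it meets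
every conull set; this supplies the hypothesis `hpos` of the equilibrium lemmas. -/
lemma exists_mem_Ioo_of_ae_workerMeasure [IsProbabilityMeasure ν] (hf : AEMeasurable f volume)
    (hpos : ∀ v, 0 < f v) {p : Worker → Prop} (h : ∀ᵐ x ∂workerMeasure f ν, p x) (c : ℝ)
    (v : unitInterval) (hc : 0 ≤ c) (hcv : c < v) :
    ∃ x : Worker, c < x.1 ∧ x.1 < v ∧ p x := by
  have h1 := ae_ae_of_ae_workerMeasure hf hpos h
  set u : unitInterval := ⟨c, hc, hcv.le.trans v.2.2⟩ with hu
  have h2 : volume (Set.Ioo u v) ≠ 0 := by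
    rw [unitInterval.volume_Ioo]
    exact (ENNReal.ofReal_pos.2 (sub_pos.2 hcv)).ne'
  obtain ⟨y, hy, hy'⟩ := ((frequently_ae_mem_iff.2 h2).and_eventually h1).exists
  obtain ⟨l, hl⟩ := hy'.exists
  exact ⟨(y, l), hy.1, hy.2, hl⟩

lemma productivity_ne_zero_ae [SFinite ν] : ∀ᵐ x ∂workerMeasure f ν, x.1 ≠ 0 := by
  have h : ∀ᵐ v : unitInterval, v ≠ 0 := by
    rw [ae_iff]
    simp
  exact Measure.quasiMeasurePreserving_fst.ae
    ((withDensity_absolutelyContinuous volume fun v => ENNReal.ofReal (f v)).ae_le h)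

/-- Almost every section of a null measurable set of workers is null measurable. -/
lemma nullMeasurableSet_section_ae [SFinite ν] (hf : AEMeasurable f volume) (hpos : ∀ v, 0 < f v)
    {s : Set Worker} (hs : NullMeasurableSet s (workerMeasure f ν)) :
    ∀ᵐ v : unitInterval, NullMeasurableSet {l | (v, l) ∈ s} ν := by
  obtain ⟨t, ht, hst⟩ := hs
  filter_upwards [ae_ae_of_ae_workerMeasure hf hpos hst] with v hv
  exact ⟨{l | (v, l) ∈ t}, measurable_prodMk_left ht, hv⟩

lemma isBertrand_of_induces [IsProbabilityMeasure ν] (hf : AEMeasurable f volume)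
    (hpos : ∀ v, 0 < f v) (hbdd : ∃ C : ℝ, ∀ v, f v ≤ C) {A : Allocation f}
    {σ : StrategyProfile (workerMeasure f ν)} (hσ : IsSubgamePerfect σ) (hA : Induces σ A) :
    A.IsBertrand := by
  have := isFiniteMeasure_productivity hbdd
  have : IsFiniteMeasure (workerMeasure f ν) := by unfold workerMeasure; infer_instance
  have hH : ∀ k, NullMeasurableSet (hired σ.announce σ.accept k) (workerMeasure f ν) :=
    fun k => (hA k).1
  have hI : ∀ p : Worker → Prop, (∀ᵐ x ∂workerMeasure f ν, p x) →
      ∀ (c : ℝ) (v : unitInterval), 0 ≤ c → c < v → ∃ x : Worker, c < x.1 ∧ x.1 < v ∧ p x :=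
    fun p hp => exists_mem_Ioo_of_ae_workerMeasure hf hpos hp
  have hfull : ∀ᵐ v : unitInterval, A.density 0 v + A.density 1 v = f v := by
    filter_upwards [ae_ae_of_ae_workerMeasure hf hpos
      (hσ.hired_ae_or (zero_ne_one) hH hI productivity_ne_zero_ae),
      nullMeasurableSet_section_ae hf hpos (hH 1), (hA 0).2, (hA 1).2] with v hv hm h0 h1
    rw [h0.1, h1.1, ← mul_add]
    have hd : Disjoint {l | (v, l) ∈ hired σ.announce σ.accept 0}
        {l | (v, l) ∈ hired σ.announce σ.accept 1} :=
      Set.disjoint_left.2 fun l hl hl' => zero_ne_one (eq_of_mem_hired hl hl')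
    have hu := measureReal_union₀ hm hd.aedisjoint
    have hone : ν ({l | (v, l) ∈ hired σ.announce σ.accept 0} ∪
        {l | (v, l) ∈ hired σ.announce σ.accept 1}) = 1 :=
      (measure_congr (Filter.eventuallyEq_univ.2 hv)).trans measure_univ
    rw [measureReal_def, hone] at hu
    simp only [measureReal_def, ENNReal.toReal_one] at hu
    rw [← hu, mul_one]
  intro i
  obtain ⟨j, hji⟩ := exists_ne i
  have hij := hji.symm
  filter_upwards [hfull, (hA i).2,
    ae_ae_of_ae_workerMeasure hf hpos (hσ.wage_eq_productivity_ae hij hH hI)] with v hv hd hw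
  refine ⟨hv, fun hp => ?_⟩
  have hne : ν {l | (v, l) ∈ hired σ.announce σ.accept i} ≠ 0 := by
    intro h0
    rw [hd.1, h0] at hp
    simp at hp
  -- One generic hired worker suffices, since `Induces` prescribes the same wage for all workers of
  -- productivity `v` hired by `i`.
  obtain ⟨l, hl, hl'⟩ := ((frequently_ae_mem_iff.2 hne).and_eventually hw).exists
  exact Option.some_injective _ ((hd.2 hp l hl).symm.trans (hl' hl))

end

/-! ### Splitting the indices and the competitive equilibrium -/

/-- The distribution function of an atomless probability measure on `[0,1]` is uniformly
distributed. -/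
lemma measureReal_setOf_measureReal_Iic_le (ν : Measure unitInterval) [IsProbabilityMeasure ν]
    [NullSingletonClass ν] {q : ℝ} (h0 : 0 ≤ q) (h1 : q ≤ 1) :
    ν.real {l | ν.real (Set.Iic l) ≤ q} = q := by
  set F : unitInterval → ℝ := fun l => ν.real (Set.Iic l) with hF
  have hmono : Monotone F := fun a b h => measureReal_mono (Set.Iic_subset_Iic.2 h)
  have hcont : Continuous F := by
    have hme : MeasurableEmbedding ((↑) : unitInterval → ℝ) :=
      MeasurableEmbedding.subtype_coe measurableSet_Icc
    have : NullSingletonClass (ν.map ((↑) : unitInterval → ℝ)) := by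
      refine ⟨fun x => ?_⟩
      rw [hme.map_apply]
      exact (Set.subsingleton_singleton.preimage Subtype.val_injective).measure_zero ν
    have : IsFiniteMeasure (ν.map ((↑) : unitInterval → ℝ)) := inferInstance
    -- The distribution function is a primitive of `1` for the atomless pushforward of `ν`; the base
    -- point `-1` lies left of the support, so `Ioc (-1) l` pulls back to `Iic l`.
    have hc := (intervalIntegral.continuous_primitive (μ := ν.map ((↑) : unitInterval → ℝ))
      (f := fun _ => (1 : ℝ)) (fun a b => intervalIntegrable_const) (-1)).comp
        (continuous_subtype_val (p := (· ∈ unitInterval)))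
    convert hc using 1
    ext l
    have hl : Set.Ioc (l : ℝ) (-1) = ∅ := Set.Ioc_eq_empty (by linarith [l.2.1])
    have hpre : ((↑) : unitInterval → ℝ) ⁻¹' Set.Ioc (-1) l = Set.Iic l := by
      ext y
      exact ⟨fun h => h.2, fun h => ⟨by linarith [y.2.1], h⟩⟩
    simp [hF, intervalIntegral.integral_const', hl, measureReal_def, hme.map_apply, hpre]
  have hF0 : F 0 = 0 := by
    have : Set.Iic (0 : unitInterval) = {0} := Set.Iic_bot
    simp [hF, measureReal_def, this]
  have hF1 : F 1 = 1 := by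
    have : Set.Iic (1 : unitInterval) = Set.univ := Set.Iic_top
    simp [hF, this]
  -- The sublevel set is `Iic s` for its greatest element `s`. A point `t` where `F` equals `q` lies
  -- below `s`, which gives `F s ≥ q`.
  obtain ⟨s, hs, hmax⟩ := (isClosed_le hcont continuous_const : IsClosed {l | F l ≤ q}).isCompact
    |>.exists_isGreatest ⟨0, hF0.le.trans h0⟩
  obtain ⟨t, ht⟩ := mem_range_of_exists_le_of_exists_ge hcont ⟨0, hF0.le.trans h0⟩
    ⟨1, h1.trans hF1.ge⟩
  have hset : {l | F l ≤ q} = Set.Iic s :=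
    Set.ext fun l => ⟨fun h => hmax h, fun h => (hmono h).trans hs⟩
  rw [hset]
  exact le_antisymm hs (ht ▸ hmono (hmax ht.le))

/-- Accept the highest wage offered, resolving ties in favour of firm `p`. -/
noncomputable def highestWageRule (p : Fin 2) : AcceptanceRule where
  choice o :=
    match o 0, o 1 with
    | none, none => none
    | some _, none => some 0
    | none, some _ => some 1
    | some w, some w' => if w' < w then some 0 else if w < w' then some 1 else some p
  available o := by
    cases h0 : o 0 <;> cases h1 : o 1 <;> simp only <;> try simp [IsAvailable, *]
    split_ifs <;> simp only [h0, h1, Option.isSome_some]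
    fin_cases p <;> simp [h0, h1]

/-- Announced wages are nonnegative, so accepting the highest one is never worse than staying
unassigned. -/
lemma isWorkerNash_highestWageRule {μ : Measure Worker} (a : Fin 2 → Announcement μ)
    (p : Worker → Fin 2) : IsWorkerNash a fun x => highestWageRule (p x) := by
  intro x c hc
  have hn0 := (a 0).nonneg_wage x
  have hn1 := (a 1).nonneg_wage x
  have hopt : ∀ o : OffersToWorker, (∀ w, o 0 = some w → 0 ≤ w) → (∀ w, o 1 = some w → 0 ≤ w) →
      IsAvailable o c →
      workerPayoff o c ≤ workerPayoff o ((highestWageRule (p x)).choice o) := by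
    intro o hn0 hn1 hc
    generalize p x = k
    rcases c with _ | c <;> cases h0 : o 0 <;> cases h1 : o 1 <;>
      simp only [h0, h1, Option.some.injEq, forall_eq'] at hn0 hn1 <;>
      simp only [highestWageRule, h0, h1] <;> (try split_ifs) <;>
      (try fin_cases c) <;> (try fin_cases k) <;>
      simp_all [workerPayoff, IsAvailable, le_of_lt]
  exact hopt _ hn0 hn1 hc

section

variable {μ : Measure Worker}

/-- Both firms offer to every worker a wage equal to her productivity, and the workers resolve ties
according to `p`. -/
noncomputable def competitiveProfile (μ : Measure Worker) (p : Worker → Fin 2) :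
    StrategyProfile μ where
  announce _ := scheduleOn Set.univ MeasurableSet.univ.nullMeasurableSet (fun v => (v : ℝ))
    (fun _ _ h => h) (fun v => v.2.1)
  accept x := highestWageRule (p x)

lemma competitiveProfile_offer (p : Worker → Fin 2) (i : Fin 2) (x : Worker) :
    ((competitiveProfile μ p).announce i).offer x = some (x.1 : ℝ) :=
  scheduleOn_offer (hT := MeasurableSet.univ.nullMeasurableSet) (hg := fun _ _ h => h)
    (h0 := fun v => v.2.1) (Set.mem_univ x)

lemma hired_competitiveProfile (p : Worker → Fin 2) (i : Fin 2) :
    hired (competitiveProfile μ p).announce (competitiveProfile μ p).accept i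
      = {x | p x = i} := by
  ext x
  change (highestWageRule (p x)).choice _ = some i ↔ _
  simp only [highestWageRule, offersTo, competitiveProfile_offer, lt_irrefl, if_false,
    Option.some.injEq, Set.mem_ofPred_eq]

/-- Equilibrium profits are zero. After any deviation each worker still holds the rival's offer of
her productivity, so whoever joins the deviator is paid at least that; a non-measurable hired set
yields `-1`. -/
lemma isSubgamePerfect_competitiveProfile (p : Worker → Fin 2)
    (hp : ∀ i, NullMeasurableSet {x | p x = i} μ) :
    IsSubgamePerfect (competitiveProfile μ p) := by
  have hN : ∀ a : Fin 2 → Announcement μ, IsWorkerNash a (competitiveProfile μ p).accept :=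
    fun a => isWorkerNash_highestWageRule a p
  refine ⟨⟨fun i b => ?_, hN _⟩, hN⟩
  have hm : margin (competitiveProfile μ p).announce i = fun _ => 0 := by
    ext x
    simp [margin, competitiveProfile_offer]
  have heq : firmPayoff (competitiveProfile μ p).announce (competitiveProfile μ p).accept i
      = 0 := by
    rw [firmPayoff, hired_competitiveProfile, if_pos (hp i), hm, if_pos integrableOn_zero]
    simp
  rw [heq, firmPayoff]
  split_ifs with h1 h2
  · obtain ⟨j, hji⟩ := exists_ne i
    rw [← EReal.coe_zero, EReal.coe_le_coe_iff]
    refine integral_nonpos_of_ae ((ae_restrict_iff'₀ h1).2 (ae_of_all _ fun x hx => ?_))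
    have hoff : (Function.update (competitiveProfile μ p).announce i b j).offer x
        = some (x.1 : ℝ) := by
      rw [Function.update_of_ne hji, competitiveProfile_offer]
    have := (hN _).le_wageOf hx hoff
    rw [margin_eq]
    simpa using this
  · exact bot_le
  · rw [EReal.neg_le, neg_zero]
    exact zero_le_one

end

-- At productivity `v`, firm `0` gets the indices whose distribution function is at most `A.density
-- 0 v / f v`. This set has exactly that mass because `ν` is atomless. Firm `1` gets the complement,
-- which is its prescribed share by full employment.
open Classical in
lemma exists_isSubgamePerfect_induces {f : unitInterval → ℝ} {ν : Measure unitInterval}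
    [IsProbabilityMeasure ν] [NullSingletonClass ν] (hf : AEMeasurable f volume)
    (hpos : ∀ v, 0 < f v) {A : Allocation f} (hA : A.IsBertrand) :
    ∃ σ : StrategyProfile (workerMeasure f ν), IsSubgamePerfect σ ∧ Induces σ A := by
  set S : Set Worker := {x | ν.real (Set.Iic x.2) * f x.1 ≤ A.density 0 x.1} with hS
  set p : Worker → Fin 2 := fun x => if x ∈ S then 0 else 1 with hp
  have hp0 : {x | p x = 0} = S := by
    ext x
    by_cases hx : x ∈ S <;> simp [hp, hx]
  have hp1 : {x | p x = 1} = Sᶜ := by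
    ext x
    by_cases hx : x ∈ S <;> simp [hp, hx]
  have hac := withDensity_absolutelyContinuous (volume : Measure unitInterval)
    fun v => ENNReal.ofReal (f v)
  have hFm : Measurable fun l : unitInterval => ν.real (Set.Iic l) :=
    Monotone.measurable fun a b h => measureReal_mono (Set.Iic_subset_Iic.2 h)
  have hSm : NullMeasurableSet S (workerMeasure f ν) :=
    nullMeasurableSet_le
      ((hFm.comp measurable_snd).aemeasurable.mul (hf.mono_ac hac).comp_fst)
      ((A.measurable_density 0).mono_ac hac).comp_fst
  have hpm : ∀ i, NullMeasurableSet {x | p x = i} (workerMeasure f ν) := by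
    intro i
    obtain rfl | rfl : i = 0 ∨ i = 1 := by omega
    · rwa [hp0]
    · rw [hp1]; exact hSm.compl
  have hsec : ∀ v, f v * ν.real {l | (v, l) ∈ S} = A.density 0 v := by
    intro v
    have : {l | (v, l) ∈ S} = {l | ν.real (Set.Iic l) ≤ A.density 0 v / f v} := by
      ext l
      simp only [hS, Set.mem_ofPred_eq, le_div_iff₀ (hpos v)]
    rw [this, measureReal_setOf_measureReal_Iic_le ν
      (div_nonneg (A.density_nonneg 0 v) (hpos v).le)
      ((div_le_one (hpos v)).2 (A.density_le 0 v)), mul_div_cancel₀ _ (hpos v).ne']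
  refine ⟨competitiveProfile _ p, isSubgamePerfect_competitiveProfile p hpm, fun i => ?_⟩
  simp only [hired_competitiveProfile, competitiveProfile_offer, Option.some.injEq]
  refine ⟨hpm i, ?_⟩
  filter_upwards [hA i] with v hv
  refine ⟨?_, fun hd l _ => (hv.2 hd).symm⟩
  obtain rfl | rfl : i = 0 ∨ i = 1 := by omega
  · rw [← hsec v, ← hp0]; rfl
  · have hSv : MeasurableSet {l | (v, l) ∈ S} :=
      measurableSet_le (hFm.mul_const (f v)) (measurable_const (a := A.density 0 v))
    have hc := probReal_compl_eq_one_sub (μ := ν) hSv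
    have hcompl : {l | p (v, l) = 1} = {l | (v, l) ∈ S}ᶜ := by
      ext l
      exact Set.ext_iff.1 hp1 (v, l)
    rw [hcompl, ← measureReal_def, hc, mul_sub, hsec v, ← hv.1]
    ring

end WageGame

theorem theorem1 (f : unitInterval → ℝ) (hf : AEMeasurable f volume)
    (hf_lower : ∃ c : ℝ, 0 < c ∧ ∀ v, c ≤ f v) (hf_upper : ∃ C : ℝ, ∀ v, f v ≤ C)
    (ν : Measure unitInterval) [IsProbabilityMeasure ν] [NullSingletonClass ν]
    (A : WageGame.Allocation f) :
    (∃ σ : WageGame.StrategyProfile (WageGame.workerMeasure f ν),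
        WageGame.IsSubgamePerfect σ ∧ WageGame.Induces σ A) ↔ A.IsBertrand := by
  obtain ⟨c, hc, hcf⟩ := hf_lower
  have hpos : ∀ v, 0 < f v := fun v => hc.trans_le (hcf v)
  exact ⟨fun ⟨_, hσ, hA⟩ => WageGame.isBertrand_of_induces hf hpos hf_upper hσ hA,
    WageGame.exists_isSubgamePerfect_induces hf hpos⟩
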